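/- **Setting.** Let $n\ge 2$. Let $\mathcal H$ be the antisymmetric Fock space over $\mathbb C^n$, with orthonormal occupation number basis $(e_I)_{I\subseteq\{1,\dots,n\}}$, standard annihilation operators $c_1,\dots,c_n$ and parity operator $\theta=(-1)^{N}$, $N=\sum_j c_j^\dagger c_j$. Alice's modes are $c_{a_j}=c_j\otimes\mathbf 1$ and Bob's modes are $c_{b_j}=\theta\otimes c_j$ on $\mathcal H\otimes\mathcal H$; the global fermion algebra is the algebra of all operators on $\mathcal H\otimes\mathcal H$. Let $K_A=K_B=\mathbb C^n\oplus\mathbb C^n$, with elements $f=(f^+,f^-)$, let $\Gamma_A=\Gamma_B$ be the antiunitary conjugation $(f^+,f^-)\mapsto(\overline{f^-},\overline{f^+})$, and let $\Gamma=\Gamma_A\oplus\Gamma_B$ on $K_{AB}=K_A\oplus K_B$. Put $\mathbf B(f)=\sum_{j}\big(f^+_{j}c_{j}+f^-_{j}c_{j}^\dagger\big)$ for $f\in K_{AB}$, the sum being over all $2n$ modes of Alice and Bob. A covariance operator is a linear operator $S$ on $K_{AB}$ with $0\le S\le\mathbf 1$ and $S+\Gamma S\Gamma=\mathbf 1$.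 A density operator $\varrho$ on $\mathcal H\otimes\mathcal H$ is the quasifree state $\varrho_S$ with covariance $S$ if its correlation functions satisfy Wick's theorem, with two-point function $\langle\Gamma f,Sg\rangle$ (scalar products are antilinear in the first argument): for all $f_1,\dots,f_m\in K_{AB}$, $\operatorname{tr}(\varrho\,\mathbf B(f_1)\cdots\mathbf B(f_m))$ is $0$ if $m$ is odd, and if $m$ is even it is the sum over all pairings $\pi$ of $\{1,\dots,m\}$ of $\operatorname{sgn}(\pi)\prod_{\{i<j\}\in\pi}\langle\Gamma f_i,Sf_j\rangle$. Write $\mathcal H=\mathcal H_+\oplus\mathcal H_-$ for the decomposition into eigenspaces of $\theta$, with $\dim\mathcal H_\pm=2^{n-1}$. The even-even subalgebra consists of the operators commuting with $\theta\otimes\mathbf 1$ and $\mathbf 1\otimes\theta$, and equals $\bigoplus_{a,b=\pm}\mathcal B(\mathcal H_a\otimes\mathcal H_b)$. The restriction of a state $\varrho$ to it has the form $\bigoplus_{a,b}p_{ab}\,\sigma_{ab}$ with probabilities $p_{ab}$ and density operators $\sigma_{ab}$ on $\mathcal H_a\otimes\mathcal H_b$. The state $\varrho$ is called maximally entangled if,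 for all $a,b$ with $p_{ab}\neq0$, $\sigma_{ab}$ is maximally entangled in the usual sense, i.e. $\sigma_{ab}$ is pure and its reduced density operator on $\mathcal H_a$ is $2^{-(n-1)}\mathbf 1$. **Theorem.** Let $\varrho_P$ be a quasifree state with covariance operator $P$ that is pure on the global fermion algebra. Then $\varrho_P$ is maximally entangled if and only if there is a unitary operator $U_{AB}\colon K_B\to K_A$ with $\Gamma_AU_{AB}=-U_{AB}\Gamma_B$ such that, with respect to $K_{AB}=K_A\oplus K_B$, $$P=\frac12\begin{pmatrix}\mathbf 1_A&U_{AB}\\U_{AB}^\dagger&\mathbf 1_B\end{pmatrix}.$$ -/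

import Mathlib

open scoped Kronecker Matrix ComplexOrder

/-!
Finite fermion systems in the occupation number representation, the selfdual description of two
parties with `n` modes each, quasifree states, and maximal entanglement with respect to the
even-even subalgebra.
-/

noncomputable section

namespace Fermion

/-- Labels of the occupation number basis `e_I`, `I ⊆ {1, …, n}`, of the antisymmetric Fock space
over `ℂⁿ`. The algebra of all operators on this space is `Matrix (Occ n) (Occ n) ℂ`. -/
abbrev Occ (n : ℕ) : Type := Finset (Fin n)

/-- Labels of the occupation number basis of the global Hilbert space (Alice's Fock space) ⊗ (Bob's
Fock space). The global fermion algebra is `Matrix (Occ₂ n) (Occ₂ n) ℂ`. -/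
abbrev Occ₂ (n : ℕ) : Type := Occ n × Occ n

/-- Labels of the canonical basis of the one-particle space `ℂⁿ ⊕ ℂⁿ` of one party; `Sum.inl j`
labels the component `f⁺_j` and `Sum.inr j` labels the component `f⁻_j`. -/
abbrev Loc (n : ℕ) : Type := Fin n ⊕ Fin n

/-- Labels of the canonical basis of the global one-particle space `K_A ⊕ K_B`. -/
abbrev Glob (n : ℕ) : Type := Loc n ⊕ Loc n

variable {n : ℕ}

/-- The annihilation operator `c_j` on the Fock space:
`c_j e_I = (-1)^{#{k ∈ I | k < j}} e_{I \ {j}}` if `j ∈ I`, and `c_j e_I = 0` otherwise. -/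
def annihilation (j : Fin n) : Matrix (Occ n) (Occ n) ℂ :=
  Matrix.of fun I' I =>
    if j ∈ I ∧ I' = I.erase j then (-1) ^ (I.filter (· < j)).card else 0

/-- The parity operator `θ = (-1)^N` of the particle number on the Fock space. -/
def parity (n : ℕ) : Matrix (Occ n) (Occ n) ℂ :=
  Matrix.diagonal fun I => (-1) ^ I.card

/-- Alice's annihilation operators `c_j ⊗ 1`. -/
def annihilationA (j : Fin n) : Matrix (Occ₂ n) (Occ₂ n) ℂ :=
  annihilation j ⊗ₖ (1 : Matrix (Occ n) (Occ n) ℂ)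

/-- Bob's annihilation operators `θ ⊗ c_j`. -/
def annihilationB (j : Fin n) : Matrix (Occ₂ n) (Occ₂ n) ℂ :=
  parity n ⊗ₖ annihilation j

/-- The fermion field operator `B(f) = ∑_j f⁺_j c_j + f⁻_j c_j†`, the sum being over all modes of
Alice and Bob. -/
def field (f : Glob n → ℂ) : Matrix (Occ₂ n) (Occ₂ n) ℂ :=
  (∑ j : Fin n, (f (.inl (.inl j)) • annihilationA j + f (.inl (.inr j)) • (annihilationA j)ᴴ)) +
    ∑ j : Fin n, (f (.inr (.inl j)) • annihilationB j + f (.inr (.inr j)) • (annihilationB j)ᴴ)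

/-- The complex conjugation `(f⁺, f⁻) ↦ (conj f⁻, conj f⁺)` on the one-particle space of one
party. -/
def conjLoc (f : Loc n → ℂ) : Loc n → ℂ := fun x => star (f x.swap)

/-- The complex conjugation `Γ` on the global one-particle space; it acts on the components of
Alice and Bob separately. -/
def conj (f : Glob n → ℂ) : Glob n → ℂ :=
  Sum.elim (conjLoc fun x => f (.inl x)) (conjLoc fun x => f (.inr x))

/-- The scalar product `⟨f, g⟩` of the global one-particle space, antilinear in `f`. -/
def scalarProd (f g : Glob n → ℂ) : ℂ := star f ⬝ᵥ g

/-- Covariance operators: `0 ≤ S ≤ 1` and `S + Γ S Γ = 1`. -/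
structure IsCovariance (S : Matrix (Glob n) (Glob n) ℂ) : Prop where
  nonneg : S.PosSemidef
  le_one : (1 - S).PosSemidef
  add_conj : ∀ f : Glob n → ℂ, S *ᵥ f + conj (S *ᵥ conj f) = f

/-- The Wick sum of a list `f_1, …, f_m` of one-particle vectors: the sum over all pairings of
`{1, …, m}`, with the sign of the pairing, of the products of the contractions
`⟨Γ f_i, S f_j⟩`, `i < j`. It is organised by the partner `i` of the first vector. It is `1` for
the empty list and `0` if `m` is odd. -/
def wick (S : Matrix (Glob n) (Glob n) ℂ) : List (Glob n → ℂ) → ℂ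
  | [] => 1
  | f :: l => ∑ i : Fin l.length,
      (-1) ^ (i : ℕ) * scalarProd (conj f) (S *ᵥ l.get i) * wick S (l.eraseIdx i)
  termination_by l => l.length
  decreasing_by
    simp only [List.length_cons]
    exact Nat.lt_succ_of_le (List.length_eraseIdx_le _ _)

/-- Density operators on the Hilbert space with orthonormal basis labelled by `ι`. -/
structure IsState {ι : Type*} [Fintype ι] (ρ : Matrix ι ι ℂ) : Prop where
  posSemidef : ρ.PosSemidef
  trace_eq_one : ρ.trace = 1

/-- Pure states `|Ω⟩⟨Ω|`, where `Ω` is a unit vector. -/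
def IsPure {ι : Type*} [Fintype ι] (ρ : Matrix ι ι ℂ) : Prop :=
  ∃ Ω : ι → ℂ, star Ω ⬝ᵥ Ω = 1 ∧ ρ = Matrix.vecMulVec Ω (star Ω)

/-- `ρ` is the quasifree state with covariance `S`: all correlation functions
`tr(ρ B(f_1) ⋯ B(f_m))` are given by the Wick sums of the two-point function
`tr(ρ B(f) B(g)) = ⟨Γ f, S g⟩`; those with odd `m` vanish. -/
structure IsQuasifree (ρ : Matrix (Occ₂ n) (Occ₂ n) ℂ) (S : Matrix (Glob n) (Glob n) ℂ) :
    Prop where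
  isState : IsState ρ
  isCovariance : IsCovariance S
  correlation : ∀ l : List (Glob n → ℂ), (ρ * (l.map field).prod).trace = wick S l

/-- Labels of the basis of the even (`a = 1`) or odd (`a = -1`) particle number subspace `H_a` of
the Fock space, that is, of the eigenspace of the parity operator with eigenvalue `a`. -/
abbrev Sector (n : ℕ) (a : ℤˣ) : Type := {I : Occ n // (-1 : ℤˣ) ^ I.card = a}

/-- The compression of `ρ` to `H_a ⊗ H_b`. The even-even subalgebra is the direct sum of the
algebras of all operators on the four spaces `H_a ⊗ H_b`, so that the direct sum of the four blocks
is the density operator of the restriction of `ρ` to the even-even subalgebra. -/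
def block (ρ : Matrix (Occ₂ n) (Occ₂ n) ℂ) (a b : ℤˣ) :
    Matrix (Sector n a × Sector n b) (Sector n a × Sector n b) ℂ :=
  ρ.submatrix (fun x => (x.1.1, x.2.1)) (fun x => (x.1.1, x.2.1))

/-- The probability `p_ab` of the block `H_a ⊗ H_b`. -/
def weight (ρ : Matrix (Occ₂ n) (Occ₂ n) ℂ) (a b : ℤˣ) : ℂ := (block ρ a b).trace

/-- The state `σ_ab` on `H_a ⊗ H_b` in the decomposition `⊕ p_ab σ_ab` of the restriction of `ρ` to
the even-even subalgebra. It is determined by `ρ` only if `p_ab ≠ 0`. -/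
def blockState (ρ : Matrix (Occ₂ n) (Occ₂ n) ℂ) (a b : ℤˣ) :
    Matrix (Sector n a × Sector n b) (Sector n a × Sector n b) ℂ :=
  (weight ρ a b)⁻¹ • block ρ a b

/-- The reduced density operator on the first tensor factor. -/
def reducedA {α β : Type*} [Fintype β] (σ : Matrix (α × β) (α × β) ℂ) : Matrix α α ℂ :=
  Matrix.of fun i i' => ∑ k : β, σ (i, k) (i', k)

/-- Maximally entangled states (in the usual sense) on a tensor product of two spaces of the same
finite dimension: pure states whose reduced density operator is maximally mixed. -/
def IsMaxEntangledPair {α β : Type*} [Fintype α] [DecidableEq α] [Fintype β]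
    (σ : Matrix (α × β) (α × β) ℂ) : Prop :=
  IsPure σ ∧ reducedA σ = ((Fintype.card α : ℂ))⁻¹ • (1 : Matrix α α ℂ)

/-- Maximally entangled bipartite fermion states: every state `σ_ab` that occurs (with nonzero
probability) in the decomposition of the restriction to the even-even subalgebra is maximally
entangled in the usual sense. -/
def IsMaximallyEntangled (ρ : Matrix (Occ₂ n) (Occ₂ n) ℂ) : Prop :=
  ∀ a b : ℤˣ, weight ρ a b ≠ 0 → IsMaxEntangledPair (blockState ρ a b)

end Fermion

end

/-!
Let `ρ = |Ω⟩⟨Ω|`, and read the coefficients of `Ω` as a matrix `X = amplitude Ω`, so that Alice's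
reduced state is `X Xᴴ`. The link between covariance and entanglement is that `P_AA = ½ 1` holds if
and only if Alice's reduced state is the tracial state. In one direction, moving one factor
of a product of fields around the trace shows that the normalized trace satisfies the Wick recursion
with covariance `½ 1` (`wick_eq_trace`). The fields generate the full matrix algebra, so
moments determine the state (`IsQuasifree.reducedA_eq`).

Sufficiency. If `P_AA = ½ 1`, then `X Xᴴ = 2⁻ⁿ 1`. A quasifree state is even, hence `Ω` has a
definite total parity, and only one of the two blocks `(a, b)` with given `a` is nonzero. That block
carries `Ω` restricted to `H_a ⊗ H_b`, and its reduction is a corner of `2⁻ⁿ 1`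
(`IsQuasifree.isMaximallyEntangled`).

Necessity. If `ρ` is maximally entangled, the even part of Alice's reduced state is `α 1 + β θ`.
For at least two modes `θ` is orthogonal to the products of two fields in the trace inner product,
whence `P_AA = ½ 1` (`IsMaximallyEntangled.toBlocks₁₁`). Thus `X` is a multiple of a unitary, Bob's
reduced state is tracial as well, and `P_BB = ½ 1`. Put `U = 2 P_AB`. By Wick's theorem Bob's field
`B(Γ g)` has the same correlations with Alice's operators as Alice's field `B(Γ U g)`. Since `X` is
invertible, `Ω` is cyclic for Alice's operators, and the two fields act identically on the state.
Comparing two-point functions gives `⟨g, k⟩ = ⟨U g, U k⟩` (`IsQuasifree.unitary`). The relation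
between `U` and `Γ` is the off-diagonal part of `P + Γ P Γ = 1`.
-/

noncomputable section

namespace Fermion

variable {n : ℕ}

/-! ### Canonical anticommutation relations -/

/-- The sign `(-1)^{#{k ∈ I | k < j}}` in the definition of `annihilation`. -/
def jwSign (j : Fin n) (I : Occ n) : ℂ := (-1) ^ (I.filter (· < j)).card

lemma jwSign_mul_self (j : Fin n) (I : Occ n) : jwSign j I * jwSign j I = 1 := by
  simp [jwSign, ← mul_pow]

lemma star_jwSign (j : Fin n) (I : Occ n) : star (jwSign j I) = jwSign j I := by
  simp [jwSign]

lemma jwSign_insert (i j : Fin n) (I : Occ n) (hi : i ∉ I) :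
    jwSign j (insert i I) = (if i < j then -1 else 1) * jwSign j I := by
  unfold jwSign
  rw [Finset.filter_insert]
  split_ifs with h
  · rw [Finset.card_insert_of_notMem (by simp [hi]), pow_succ]; ring
  · simp

lemma jwSign_erase (i j : Fin n) (I : Occ n) (hi : i ∈ I) :
    jwSign j (I.erase i) = (if i < j then -1 else 1) * jwSign j I := by
  conv_rhs => rw [← Finset.insert_erase hi, jwSign_insert _ _ _ (Finset.notMem_erase i I)]
  split_ifs <;> simp

lemma annihilation_apply (j : Fin n) (K I : Occ n) :
    annihilation j K I = if j ∈ I ∧ K = I.erase j then jwSign j I else 0 := rfl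

lemma creation_apply (j : Fin n) (K I : Occ n) :
    (annihilation j)ᴴ K I = if j ∉ I ∧ K = insert j I then jwSign j I else 0 := by
  rw [Matrix.conjTranspose_apply, annihilation_apply]
  by_cases h : j ∈ K ∧ I = K.erase j
  · obtain ⟨h, rfl⟩ := h
    simp [h, jwSign_erase, star_jwSign]
  · rw [if_neg h, if_neg, star_zero]
    rintro ⟨h1, rfl⟩
    exact h (by simp [h1])

lemma mul_annihilation_apply (M : Matrix (Occ n) (Occ n) ℂ) (j : Fin n) (K I : Occ n) :
    (M * annihilation j) K I = if j ∈ I then M K (I.erase j) * jwSign j I else 0 := by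
  simp only [Matrix.mul_apply, annihilation_apply]
  by_cases h : j ∈ I <;> simp [h]

lemma mul_creation_apply (M : Matrix (Occ n) (Occ n) ℂ) (j : Fin n) (K I : Occ n) :
    (M * (annihilation j)ᴴ) K I = if j ∉ I then M K (insert j I) * jwSign j I else 0 := by
  simp only [Matrix.mul_apply, creation_apply]
  by_cases h : j ∈ I <;> simp [h]

lemma annihilation_anticomm (i j : Fin n) :
    annihilation i * annihilation j + annihilation j * annihilation i = 0 := by
  ext K I
  simp only [Matrix.add_apply, mul_annihilation_apply, annihilation_apply, Finset.mem_erase,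
    Matrix.zero_apply]
  rcases eq_or_ne i j with rfl | hij
  · simp
  by_cases hi : i ∈ I <;> by_cases hj : j ∈ I <;> simp [hi, hj, hij, hij.symm]
  rw [Finset.erase_right_comm, jwSign_erase _ _ _ hi, jwSign_erase _ _ _ hj]
  rcases lt_or_gt_of_ne hij with h | h <;> simp [h, h.not_gt] <;> split_ifs <;> ring

lemma annihilation_creation_anticomm (i j : Fin n) :
    annihilation i * (annihilation j)ᴴ + (annihilation j)ᴴ * annihilation i =
      if i = j then 1 else 0 := by
  ext K I
  simp only [Matrix.add_apply, mul_annihilation_apply, mul_creation_apply, annihilation_apply,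
    creation_apply, Finset.mem_erase, Finset.mem_insert]
  rcases eq_or_ne i j with rfl | hij
  · by_cases hi : i ∈ I
    · simp [hi, jwSign_erase, Matrix.one_apply, jwSign_mul_self]
    · simp [hi, jwSign_insert, Matrix.one_apply, jwSign_mul_self]
  · by_cases hi : i ∈ I <;> by_cases hj : j ∈ I <;> simp [hi, hj, hij, hij.symm]
    rw [Finset.erase_insert_of_ne hij.symm, jwSign_erase _ _ _ hi, jwSign_insert _ _ _ hj]
    rcases lt_or_gt_of_ne hij with h | h <;> simp [h, h.not_gt] <;> split_ifs <;> ring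

lemma creation_anticomm (i j : Fin n) :
    (annihilation i)ᴴ * (annihilation j)ᴴ + (annihilation j)ᴴ * (annihilation i)ᴴ = 0 := by
  have h := congrArg Matrix.conjTranspose (annihilation_anticomm j i)
  simpa [Matrix.conjTranspose_mul] using h

lemma parity_mul_annihilation (j : Fin n) :
    parity n * annihilation j = -(annihilation j * parity n) := by
  ext K I
  rw [parity, Matrix.diagonal_mul, Matrix.neg_apply, Matrix.mul_diagonal, annihilation_apply]
  split_ifs with h
  · obtain ⟨h, rfl⟩ := h
    rw [← Finset.card_erase_add_one h, pow_succ]; ring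
  · simp

lemma conjTranspose_parity : (parity n)ᴴ = parity n := by
  simp only [parity, Matrix.diagonal_conjTranspose]
  congr 1; ext I; simp

lemma parity_mul_self : parity n * parity n = 1 := by
  simp [parity, ← mul_pow]

lemma parity_mul_creation (j : Fin n) :
    parity n * (annihilation j)ᴴ = -((annihilation j)ᴴ * parity n) := by
  have h := congrArg Matrix.conjTranspose (parity_mul_annihilation j)
  simp only [Matrix.conjTranspose_mul, Matrix.conjTranspose_neg, conjTranspose_parity] at h
  rw [h, neg_neg]

/-- The field operator `b(f) = ∑_j f⁺_j c_j + f⁻_j c_j†` of a single party. -/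
def locField (f : Loc n → ℂ) : Matrix (Occ n) (Occ n) ℂ :=
  ∑ j : Fin n, (f (.inl j) • annihilation j + f (.inr j) • (annihilation j)ᴴ)

/-- The bilinear form `⟨Γ f, g⟩` on the one-particle space of one party. -/
def pairing (f g : Loc n → ℂ) : ℂ := ∑ x, f (Sum.swap x) * g x

lemma locField_anticomm (f g : Loc n → ℂ) :
    locField f * locField g + locField g * locField f = pairing f g • 1 := by
  have key : ∀ i j : Fin n,
      (f (.inl i) • annihilation i + f (.inr i) • (annihilation i)ᴴ) *
        (g (.inl j) • annihilation j + g (.inr j) • (annihilation j)ᴴ) +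
      (g (.inl j) • annihilation j + g (.inr j) • (annihilation j)ᴴ) *
        (f (.inl i) • annihilation i + f (.inr i) • (annihilation i)ᴴ) =
      if i = j then (f (.inl i) * g (.inr j) + f (.inr i) * g (.inl j)) •
        (1 : Matrix (Occ n) (Occ n) ℂ) else 0 := by
    intro i j
    have h1 := annihilation_anticomm i j
    have h2 := creation_anticomm i j
    have h3 := annihilation_creation_anticomm i j
    have h4 := annihilation_creation_anticomm j i
    calc _ = (f (.inl i) * g (.inl j)) •
              (annihilation i * annihilation j + annihilation j * annihilation i) +
            (f (.inr i) * g (.inr j)) • ((annihilation i)ᴴ * (annihilation j)ᴴ +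
              (annihilation j)ᴴ * (annihilation i)ᴴ) +
            (f (.inl i) * g (.inr j)) • (annihilation i * (annihilation j)ᴴ +
              (annihilation j)ᴴ * annihilation i) +
            (f (.inr i) * g (.inl j)) • (annihilation j * (annihilation i)ᴴ +
              (annihilation i)ᴴ * annihilation j) := by
          simp only [mul_add, add_mul, smul_mul_smul_comm, smul_add,
            mul_comm (g _) (f _)]
          abel
      _ = _ := by
          rw [h1, h2, h3, h4]
          rcases eq_or_ne i j with rfl | hij
          · simp [add_smul]
          · simp [hij, hij.symm]
  unfold locField pairing
  rw [Finset.sum_mul_sum, Finset.sum_mul_sum, Finset.sum_comm (γ := Fin n) (s := Finset.univ)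
    (f := fun i j => (g (.inl i) • annihilation i + g (.inr i) • (annihilation i)ᴴ) *
        (f (.inl j) • annihilation j + f (.inr j) • (annihilation j)ᴴ)), ← Finset.sum_add_distrib]
  simp_rw [← Finset.sum_add_distrib, key]
  simp only [Finset.sum_ite_eq, Finset.mem_univ, if_true, Fintype.sum_sum_type, Sum.swap_inl,
    Sum.swap_inr]
  rw [← Finset.sum_smul, Finset.sum_add_distrib, add_comm]

lemma parity_mul_locField (f : Loc n → ℂ) :
    parity n * locField f = -(locField f * parity n) := by
  simp only [locField, Finset.mul_sum, Finset.sum_mul, mul_add, add_mul, Matrix.mul_smul,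
    Matrix.smul_mul, parity_mul_annihilation, parity_mul_creation, ← Finset.sum_neg_distrib,
    smul_neg, neg_add]

lemma field_eq (f : Glob n → ℂ) :
    field f = locField (fun x => f (.inl x)) ⊗ₖ 1 + parity n ⊗ₖ locField (fun x => f (.inr x)) := by
  have hA : ∀ j : Fin n, (annihilationA j)ᴴ = (annihilation j)ᴴ ⊗ₖ 1 := fun j => by
    rw [annihilationA, Matrix.conjTranspose_kronecker, Matrix.conjTranspose_one]
  have hB : ∀ j : Fin n, (annihilationB j)ᴴ = parity n ⊗ₖ (annihilation j)ᴴ := fun j => by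
    rw [annihilationB, Matrix.conjTranspose_kronecker, conjTranspose_parity]
  unfold field
  simp only [hA, hB]
  unfold annihilationA annihilationB
  congr 1
  · ext x y
    simp [locField, Matrix.sum_apply, Finset.sum_mul, Matrix.kroneckerMap_apply, add_mul, mul_assoc]
  · ext x y
    simp only [locField, Matrix.sum_apply, Finset.mul_sum, Matrix.kroneckerMap_apply,
      Matrix.add_apply, Matrix.smul_apply, smul_eq_mul]
    exact Finset.sum_congr rfl fun j _ => by ring

lemma locField_zero : locField (0 : Loc n → ℂ) = 0 := by simp [locField]

lemma field_inl (f : Loc n → ℂ) : field (Sum.elim f 0) = locField f ⊗ₖ 1 := by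
  have : (fun x => (Sum.elim f 0 : Glob n → ℂ) (.inr x)) = 0 := rfl
  rw [field_eq, this, locField_zero, Matrix.kronecker_zero, add_zero]; rfl

lemma field_inr (f : Loc n → ℂ) : field (Sum.elim 0 f) = parity n ⊗ₖ locField f := by
  have : (fun x => (Sum.elim 0 f : Glob n → ℂ) (.inl x)) = 0 := rfl
  rw [field_eq, this, locField_zero, Matrix.zero_kronecker, zero_add]; rfl

lemma locField_single_inl (j : Fin n) : locField (Pi.single (.inl j) 1) = annihilation j := by
  simp [locField, Pi.single_apply, ite_smul]

lemma locField_single_inr (j : Fin n) : locField (Pi.single (.inr j) 1) = (annihilation j)ᴴ := by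
  simp [locField, Pi.single_apply, ite_smul]

/-! ### Irreducibility of the field operators -/

/-- The fields of one party generate all operators: every matrix unit is, up to a sign, a product of
creation operators, the vacuum projection `∏_j c_j c_j†` and annihilation operators. -/
lemma adjoin_range_locField :
    Algebra.adjoin ℂ (Set.range (locField : (Loc n → ℂ) → _)) = ⊤ := by
  set 𝒜 := Algebra.adjoin ℂ (Set.range (locField : (Loc n → ℂ) → _))
  have ha : ∀ j : Fin n, annihilation j ∈ 𝒜 := fun j =>
    Algebra.subset_adjoin ⟨_, locField_single_inl j⟩
  have hc : ∀ j : Fin n, (annihilation j)ᴴ ∈ 𝒜 := fun j =>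
    Algebra.subset_adjoin ⟨_, locField_single_inr j⟩
  -- `∏_{j ∈ s} c_j c_j†` projects onto the span of the `e_I` with `I ∩ s = ∅`
  have hvac : ∀ s : Finset (Fin n),
      Matrix.diagonal (fun I : Occ n => if Disjoint s I then (1 : ℂ) else 0) ∈ 𝒜 := by
    intro s
    induction s using Finset.induction_on with
    | empty => simp
    | insert j s hj ih =>
      convert 𝒜.mul_mem ih (𝒜.mul_mem (ha j) (hc j)) using 1
      ext K I
      rw [Matrix.diagonal_mul, mul_creation_apply, annihilation_apply, Matrix.diagonal_apply]
      simp only [Finset.disjoint_insert_left]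
      by_cases hI : j ∈ I
      · rcases eq_or_ne K I with rfl | hK <;> simp [*]
      · rcases eq_or_ne K I with rfl | hK <;> simp [*, jwSign_insert, jwSign_mul_self]
  have h0 : Matrix.single ∅ ∅ (1 : ℂ) ∈ 𝒜 := by
    convert hvac Finset.univ using 1
    ext K I
    rw [Matrix.single_apply, Matrix.diagonal_apply]
    have : Disjoint Finset.univ K ↔ ∅ = K := by
      rw [← Finset.top_eq_univ, top_disjoint, eq_comm]; rfl
    by_cases hK : ∅ = K <;> by_cases hI : ∅ = I <;> by_cases hKI : K = I <;> simp_all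
  have h1 : ∀ I : Occ n, Matrix.single ∅ I (1 : ℂ) ∈ 𝒜 := by
    intro I
    induction I using Finset.induction_on with
    | empty => exact h0
    | insert j s hj ih =>
      convert 𝒜.smul_mem (𝒜.mul_mem ih (ha j)) (jwSign j s) using 1
      ext K I
      rw [Matrix.smul_apply, mul_annihilation_apply, Matrix.single_apply, Matrix.single_apply]
      by_cases hI : insert j s = I
      · subst hI
        by_cases hK : ∅ = K <;> simp [hK, hj, jwSign_insert, jwSign_mul_self]
      · have : ¬ (j ∈ I ∧ s = I.erase j) := by
          rintro ⟨h, rfl⟩; exact hI (Finset.insert_erase h)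
        by_cases h : j ∈ I <;> simp_all
  have h2 : ∀ K I : Occ n, Matrix.single K I (1 : ℂ) ∈ 𝒜 := by
    intro K I
    induction K using Finset.induction_on with
    | empty => exact h1 I
    | insert j s hj ih =>
      convert 𝒜.smul_mem (𝒜.mul_mem (hc j) ih) (jwSign j s) using 1
      ext K I'
      rcases eq_or_ne I I' with rfl | hI
      · rw [Matrix.smul_apply, Matrix.mul_single_apply_same, creation_apply, Matrix.single_apply]
        by_cases hK : insert j s = K
        · subst hK; simp [hj, jwSign_mul_self]
        · simp [hK, Ne.symm hK]
      · rw [Matrix.smul_apply, Matrix.mul_single_apply_of_ne _ _ _ _ _ hI.symm,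
          Matrix.single_apply_of_ne]
        · simp
        · simp [hI]
  rw [eq_top_iff]
  intro M _
  rw [Matrix.matrix_eq_sum_single M]
  refine 𝒜.sum_mem fun i _ => 𝒜.sum_mem fun j _ => ?_
  simpa using 𝒜.smul_mem (h2 i j) (M i j)

/-- The global field operators generate all operators: `θ ⊗ 1` is generated by Alice's fields, and
it turns Bob's fields `θ ⊗ b(g)` into `1 ⊗ b(g)`. -/
lemma adjoin_range_field :
    Algebra.adjoin ℂ (Set.range (field : (Glob n → ℂ) → _)) = ⊤ := by
  set 𝒜 := Algebra.adjoin ℂ (Set.range (field : (Glob n → ℂ) → _))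
  have hA : ∀ M : Matrix (Occ n) (Occ n) ℂ, M ⊗ₖ (1 : Matrix (Occ n) (Occ n) ℂ) ∈ 𝒜 := by
    intro M
    have hM : M ∈ Algebra.adjoin ℂ (Set.range (locField : (Loc n → ℂ) → _)) := by
      rw [adjoin_range_locField]; trivial
    induction hM using Algebra.adjoin_induction with
    | mem x hx =>
      obtain ⟨f, rfl⟩ := hx
      exact Algebra.subset_adjoin ⟨_, field_inl f⟩
    | algebraMap r =>
      rw [Algebra.algebraMap_eq_smul_one, Matrix.smul_kronecker, Matrix.one_kronecker_one]
      exact 𝒜.smul_mem 𝒜.one_mem r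
    | add x y _ _ hx hy => rw [Matrix.add_kronecker]; exact 𝒜.add_mem hx hy
    | mul x y _ _ hx hy =>
      rw [← mul_one (1 : Matrix (Occ n) (Occ n) ℂ), Matrix.mul_kronecker_mul]
      exact 𝒜.mul_mem hx hy
  have hB : ∀ M : Matrix (Occ n) (Occ n) ℂ, (1 : Matrix (Occ n) (Occ n) ℂ) ⊗ₖ M ∈ 𝒜 := by
    intro M
    have hM : M ∈ Algebra.adjoin ℂ (Set.range (locField : (Loc n → ℂ) → _)) := by
      rw [adjoin_range_locField]; trivial
    induction hM using Algebra.adjoin_induction with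
    | mem x hx =>
      obtain ⟨f, rfl⟩ := hx
      have := 𝒜.mul_mem (hA (parity n)) (Algebra.subset_adjoin ⟨_, field_inr f⟩)
      rwa [← Matrix.mul_kronecker_mul, parity_mul_self, one_mul] at this
    | algebraMap r =>
      rw [Algebra.algebraMap_eq_smul_one, Matrix.kronecker_smul, Matrix.one_kronecker_one]
      exact 𝒜.smul_mem 𝒜.one_mem r
    | add x y _ _ hx hy => rw [Matrix.kronecker_add]; exact 𝒜.add_mem hx hy
    | mul x y _ _ hx hy =>
      rw [← mul_one (1 : Matrix (Occ n) (Occ n) ℂ), Matrix.mul_kronecker_mul]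
      exact 𝒜.mul_mem hx hy
  rw [eq_top_iff]
  intro M _
  rw [Matrix.matrix_eq_sum_single M]
  refine 𝒜.sum_mem fun i _ => 𝒜.sum_mem fun j _ => ?_
  have h := 𝒜.smul_mem (𝒜.mul_mem (hA (Matrix.single i.1 j.1 1)) (hB (Matrix.single i.2 j.2 1)))
    (M i j)
  rw [← Matrix.mul_kronecker_mul, mul_one, one_mul, Matrix.single_kronecker_single] at h
  simpa using h

/-- If the operators `F x` generate the full matrix algebra, a matrix is determined by its trace
pairings with the products of the `F x`. -/
lemma eq_of_trace_mul_prod {ι κ : Type*} [Fintype ι] [DecidableEq ι] {F : κ → Matrix ι ι ℂ}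
    (hF : Algebra.adjoin ℂ (Set.range F) = ⊤) {M N : Matrix ι ι ℂ}
    (h : ∀ l : List κ, (M * (l.map F).prod).trace = (N * (l.map F).prod).trace) : M = N := by
  refine Matrix.ext_iff_trace_mul_right.2 fun A => ?_
  have hA : A ∈ Submodule.span ℂ (Submonoid.closure (Set.range F) : Set (Matrix ι ι ℂ)) := by
    rw [← Algebra.adjoin_eq_span, hF]; trivial
  induction hA using Submodule.span_induction with
  | mem x hx =>
    obtain ⟨l, hl, rfl⟩ := Submonoid.exists_list_of_mem_closure hx
    obtain ⟨l', rfl⟩ : l ∈ Set.range (List.map F) := by rwa [Set.range_list_map]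
    exact h l'
  | zero => simp
  | add x y _ _ hx hy => simp [mul_add, hx, hy]
  | smul a x _ hx => simp [hx]

/-! ### Traces of products of fields -/

/-- Anticommuting a field operator through a product of field operators. -/
lemma locField_mul_prod (f : Loc n → ℂ) (l : List (Loc n → ℂ)) :
    locField f * (l.map locField).prod =
      ∑ i : Fin l.length, ((-1) ^ (i : ℕ) * pairing f (l.get i)) •
        ((l.eraseIdx i).map locField).prod +
      (-1 : ℂ) ^ l.length • ((l.map locField).prod * locField f) := by
  induction l with
  | nil => simp
  | cons g t ih =>
    have h := eq_sub_of_add_eq (locField_anticomm f g)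
    rw [List.map_cons, List.prod_cons, ← mul_assoc, h, sub_mul, mul_assoc (locField g), ih,
      smul_mul_assoc, one_mul, mul_add, Finset.mul_sum]
    refine Eq.trans ?_ (congrArg (· + (-1 : ℂ) ^ (t.length + 1) •
      (((g :: t).map locField).prod * locField f)) (Fin.sum_univ_succ (n := t.length) fun i =>
        ((-1) ^ (i : ℕ) * pairing f ((g :: t).get i)) •
          (((g :: t).eraseIdx i).map locField).prod).symm)
    simp only [List.get_cons_zero, List.get_cons_succ', Fin.val_zero, List.eraseIdx_zero,
      List.tail_cons, Fin.val_succ, List.eraseIdx_cons_succ, List.map_cons, List.prod_cons, pow_succ,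
      pow_zero, one_mul, mul_neg_one, neg_mul, neg_smul, Finset.sum_neg_distrib, mul_smul_comm,
      mul_assoc]
    abel

lemma parity_mul_prod (l : List (Loc n → ℂ)) :
    parity n * (l.map locField).prod =
      (-1 : ℂ) ^ l.length • ((l.map locField).prod * parity n) := by
  induction l with
  | nil => simp
  | cons g t ih =>
    rw [List.map_cons, List.prod_cons, ← mul_assoc, parity_mul_locField, neg_mul, mul_assoc, ih]
    simp [pow_succ, mul_assoc]

lemma trace_prod_of_odd (l : List (Loc n → ℂ)) (hl : Odd l.length) :
    ((l.map locField).prod).trace = 0 := by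
  have h := congrArg (fun M => (M * parity n).trace) (parity_mul_prod l)
  simp only [hl.neg_one_pow, neg_smul, one_smul, neg_mul, Matrix.trace_neg, mul_assoc,
    parity_mul_self, mul_one] at h
  rw [Matrix.trace_mul_comm, mul_assoc, parity_mul_self, mul_one] at h
  exact CharZero.eq_neg_self_iff.mp h

lemma wick_cons (S : Matrix (Glob n) (Glob n) ℂ) (f : Glob n → ℂ) (l : List (Glob n → ℂ)) :
    wick S (f :: l) = ∑ i : Fin l.length,
      (-1) ^ (i : ℕ) * scalarProd (conj f) (S *ᵥ l.get i) * wick S (l.eraseIdx i) := by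
  rw [wick]

lemma wick_of_odd (S : Matrix (Glob n) (Glob n) ℂ) (l : List (Glob n → ℂ)) (hl : Odd l.length) :
    wick S l = 0 := by
  match l with
  | [] => simp at hl
  | f :: l =>
    rw [wick_cons]
    refine Finset.sum_eq_zero fun i _ => ?_
    rw [wick_of_odd S (l.eraseIdx i), mul_zero]
    have := i.2
    rw [List.length_eraseIdx_of_lt i.2]
    rw [List.length_cons] at hl
    grind
  termination_by l.length
  decreasing_by
    simp only [List.length_cons]
    exact Nat.lt_succ_of_le (List.length_eraseIdx_le _ _)

lemma wick_pair (S : Matrix (Glob n) (Glob n) ℂ) (f g : Glob n → ℂ) :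
    wick S [f, g] = scalarProd (conj f) (S *ᵥ g) := by
  rw [wick_cons]
  have : wick S [] = 1 := by rw [wick]
  simp [this]

/-- If Alice's contractions are those of `½ 1`, the Wick sums are the moments of the normalized
trace: moving the first factor around the trace gives the recursion that defines `wick`. -/
lemma wick_eq_trace {S : Matrix (Glob n) (Glob n) ℂ}
    (hS : ∀ f g : Loc n → ℂ, scalarProd (conj (Sum.elim f 0)) (S *ᵥ Sum.elim g 0) =
      pairing f g / 2) (l : List (Loc n → ℂ)) :
    wick S (l.map fun f => Sum.elim f 0) = ((l.map locField).prod).trace / 2 ^ n := by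
  by_cases hodd : Odd l.length
  · rw [wick_of_odd _ _ (by simpa using hodd), trace_prod_of_odd _ hodd, zero_div]
  match l with
  | [] => simp [wick, Matrix.trace_one, Fintype.card_finset]
  | f :: l =>
    have hl : Odd l.length := by
      rw [List.length_cons] at hodd; grind
    have h := congrArg Matrix.trace (locField_mul_prod f l)
    rw [hl.neg_one_pow, neg_one_smul, Matrix.trace_add, Matrix.trace_neg,
      Matrix.trace_mul_comm _ (locField f), Matrix.trace_sum] at h
    -- an odd number of anticommutations and cyclicity of the trace give the trace twice
    have h2 : (locField f * (l.map locField).prod).trace =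
        ∑ i : Fin l.length, ((-1) ^ (i : ℕ) * (pairing f (l.get i) / 2)) *
          ((l.eraseIdx i).map locField).prod.trace := by
      have h3 := eq_add_neg_iff_add_eq.mp h
      rw [← two_mul] at h3
      rw [eq_div_of_mul_eq two_ne_zero ((mul_comm _ _).trans h3), Finset.sum_div]
      refine Finset.sum_congr rfl fun i _ => ?_
      rw [Matrix.trace_smul, smul_eq_mul]; ring
    rw [List.map_cons, List.map_cons, List.prod_cons, h2, wick_cons, Finset.sum_div]
    refine Fintype.sum_equiv (finCongr (List.length_map _)) _ _ fun i => ?_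
    have hi : (i : ℕ) < l.length := by simpa using i.2
    simp only [finCongr_apply, Fin.val_cast, List.get_eq_getElem, List.getElem_map]
    rw [hS, List.eraseIdx_map, wick_eq_trace hS (l.eraseIdx i)]
    ring
  termination_by l.length
  decreasing_by
    simp only [List.length_cons]
    exact Nat.lt_succ_of_le (List.length_eraseIdx_le _ _)

lemma trace_locField_mul (f g : Loc n → ℂ) :
    (locField f * locField g).trace = pairing f g / 2 * 2 ^ n := by
  have h := congrArg Matrix.trace (locField_anticomm f g)
  rw [Matrix.trace_add, Matrix.trace_mul_comm (locField g), ← two_mul, Matrix.trace_smul,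
    Matrix.trace_one, Fintype.card_finset, Fintype.card_fin] at h
  push_cast at h
  rw [smul_eq_mul] at h
  linear_combination h / 2

lemma locField_mul_locField_diag (f g : Loc n → ℂ) (I : Occ n) :
    (locField f * locField g) I I =
      ∑ j, if j ∈ I then f (.inr j) * g (.inl j) else f (.inl j) * g (.inr j) := by
  have h1 : ∀ i j : Fin n, (annihilation i * annihilation j) I I = 0 := by
    intro i j
    rw [mul_annihilation_apply, annihilation_apply]
    split_ifs with h h'
    · have : j ∈ (I.erase j).erase i := by rw [← h'.2]; exact h
      simp at this
    all_goals simp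
  have h2 : ∀ i j : Fin n, ((annihilation i)ᴴ * (annihilation j)ᴴ) I I = 0 := by
    intro i j
    rw [mul_creation_apply, creation_apply]
    by_cases h : j ∈ I
    · simp [h]
    · rw [if_pos h, if_neg, zero_mul]
      rintro ⟨-, h'⟩
      exact h (h' ▸ by simp)
  have h3 : ∀ i j : Fin n, (annihilation i * (annihilation j)ᴴ) I I =
      if i = j then if j ∈ I then 0 else 1 else 0 := by
    intro i j
    rw [mul_creation_apply, annihilation_apply]
    rcases eq_or_ne i j with rfl | hij
    · by_cases h : i ∈ I <;> simp [h, jwSign_insert, jwSign_mul_self]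
    · by_cases h : j ∈ I <;> simp only [h, hij, not_true, not_false_iff, if_true, if_false]
      rw [if_neg, zero_mul]
      rintro ⟨-, h'⟩
      exact h (h' ▸ by simp [hij.symm])
  have h4 : ∀ i j : Fin n, ((annihilation i)ᴴ * annihilation j) I I =
      if i = j then if j ∈ I then 1 else 0 else 0 := by
    intro i j
    rw [mul_annihilation_apply, creation_apply]
    rcases eq_or_ne i j with rfl | hij
    · by_cases h : i ∈ I <;> simp [h, jwSign_erase, jwSign_mul_self]
    · by_cases h : j ∈ I <;> simp only [h, hij, if_true, if_false]
      rw [if_neg, zero_mul]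
      rintro ⟨-, h'⟩
      have : j ∈ insert i (I.erase j) := h' ▸ h
      simp [hij.symm] at this
  unfold locField
  simp only [Finset.sum_mul_sum, Matrix.sum_apply, add_mul, mul_add, smul_mul_smul_comm,
    Matrix.add_apply, Matrix.smul_apply, h1, h2, h3, h4, smul_eq_mul, mul_zero, zero_add, add_zero,
    mul_ite, mul_one]
  simp only [Finset.sum_add_distrib, Finset.sum_ite_eq, Finset.mem_univ, if_true]
  rw [← Finset.sum_add_distrib]
  refine Finset.sum_congr rfl fun j _ => ?_
  split_ifs <;> simp

lemma neg_one_pow_card_symmDiff (k : Fin n) (I : Occ n) :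
    (-1 : ℂ) ^ (symmDiff I {k}).card = -(-1) ^ I.card := by
  by_cases h : k ∈ I
  · have : symmDiff I {k} = I.erase k := by
      ext x; simp only [Finset.mem_symmDiff, Finset.mem_singleton, Finset.mem_erase]; grind
    rw [this, ← Finset.card_erase_add_one h, pow_succ]; ring
  · have : symmDiff I {k} = insert k I := by
      ext x; simp only [Finset.mem_symmDiff, Finset.mem_singleton, Finset.mem_insert]; grind
    rw [this, Finset.card_insert_of_notMem h, pow_succ]; ring

/-- An alternating sum vanishes if the summand does not depend on the occupation of some mode. -/
lemma sum_neg_one_pow_card_mul (k : Fin n) (F : Occ n → ℂ)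
    (hF : ∀ I, F (symmDiff I {k}) = F I) : ∑ I : Occ n, (-1) ^ I.card * F I = 0 := by
  have h := Equiv.sum_comp (symmDiff_left_involutive ({k} : Occ n)).toPerm
    fun I : Occ n => (-1 : ℂ) ^ I.card * F I
  simp only [Function.Involutive.coe_toPerm, hF, neg_one_pow_card_symmDiff, neg_mul,
    Finset.sum_neg_distrib] at h
  exact CharZero.eq_neg_self_iff.mp h.symm

lemma trace_parity (hn : 1 ≤ n) : (parity n).trace = 0 := by
  have := sum_neg_one_pow_card_mul (⟨0, hn⟩ : Fin n) (fun _ => 1) fun _ => rfl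
  simpa [parity, Matrix.trace] using this

/-- For a single mode `θ` is itself quadratic in the fields, so at least two modes are needed. -/
lemma trace_parity_mul_locField (hn : 2 ≤ n) (f g : Loc n → ℂ) :
    (parity n * (locField f * locField g)).trace = 0 := by
  have : Nontrivial (Fin n) := Fin.nontrivial_iff_two_le.mpr hn
  simp only [Matrix.trace, Matrix.diag_apply, parity, Matrix.diagonal_mul,
    locField_mul_locField_diag, Finset.mul_sum]
  rw [Finset.sum_comm]
  refine Finset.sum_eq_zero fun j _ => ?_
  obtain ⟨k, hk⟩ := exists_ne j
  refine sum_neg_one_pow_card_mul k _ fun I => ?_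
  have : j ∈ symmDiff I {k} ↔ j ∈ I := by
    simp [Finset.mem_symmDiff, hk.symm]
  simp only [this]

/-! ### Two-point functions and reduced states -/

lemma pairing_left_injective {v w : Loc n → ℂ} (h : ∀ f, pairing f v = pairing f w) : v = w := by
  funext x
  have h := h (Pi.single x.swap 1)
  rcases x with j | j <;> simpa [pairing, Pi.single_apply] using h

lemma eq_half_of_pairing {M : Matrix (Loc n) (Loc n) ℂ}
    (h : ∀ f g, pairing f (M *ᵥ g) = pairing f g / 2) : M = (1 / 2 : ℂ) • 1 := by
  refine Matrix.ext_of_mulVec_single fun i => pairing_left_injective fun f => ?_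
  rw [h, Matrix.smul_mulVec, Matrix.one_mulVec]
  simp only [pairing, Pi.smul_apply, smul_eq_mul, Finset.sum_div]
  exact Finset.sum_congr rfl fun x _ => by ring

lemma scalarProd_conj (f v : Glob n → ℂ) :
    scalarProd (conj f) v = pairing (fun x => f (.inl x)) (fun x => v (.inl x)) +
      pairing (fun x => f (.inr x)) (fun x => v (.inr x)) := by
  simp only [scalarProd, dotProduct, Fintype.sum_sum_type, pairing, conj, conjLoc, Pi.star_apply,
    Sum.elim_inl, Sum.elim_inr, star_star]

lemma pairing_zero_left (v : Loc n → ℂ) : pairing 0 v = 0 := by simp [pairing]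

section
variable (P : Matrix (Glob n) (Glob n) ℂ) (f g : Loc n → ℂ)

lemma scalarProd_inl_inl :
    scalarProd (conj (Sum.elim f 0)) (P *ᵥ Sum.elim g 0) = pairing f (P.toBlocks₁₁ *ᵥ g) := by
  conv_lhs => rw [← Matrix.fromBlocks_toBlocks P, Matrix.fromBlocks_mulVec, scalarProd_conj]
  simp [Function.comp_def, ← Pi.zero_def, pairing_zero_left]

lemma scalarProd_inl_inr :
    scalarProd (conj (Sum.elim f 0)) (P *ᵥ Sum.elim 0 g) = pairing f (P.toBlocks₁₂ *ᵥ g) := by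
  conv_lhs => rw [← Matrix.fromBlocks_toBlocks P, Matrix.fromBlocks_mulVec, scalarProd_conj]
  simp [Function.comp_def, ← Pi.zero_def, pairing_zero_left]

lemma scalarProd_inr_inl :
    scalarProd (conj (Sum.elim 0 f)) (P *ᵥ Sum.elim g 0) = pairing f (P.toBlocks₂₁ *ᵥ g) := by
  conv_lhs => rw [← Matrix.fromBlocks_toBlocks P, Matrix.fromBlocks_mulVec, scalarProd_conj]
  simp [Function.comp_def, ← Pi.zero_def, pairing_zero_left]

lemma scalarProd_inr_inr :
    scalarProd (conj (Sum.elim 0 f)) (P *ᵥ Sum.elim 0 g) = pairing f (P.toBlocks₂₂ *ᵥ g) := by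
  conv_lhs => rw [← Matrix.fromBlocks_toBlocks P, Matrix.fromBlocks_mulVec, scalarProd_conj]
  simp [Function.comp_def, ← Pi.zero_def, pairing_zero_left]

end

lemma IsQuasifree.trace_field_mul_field {ρ : Matrix (Occ₂ n) (Occ₂ n) ℂ}
    {P : Matrix (Glob n) (Glob n) ℂ} (hρ : IsQuasifree ρ P) (f g : Glob n → ℂ) :
    (ρ * (field f * field g)).trace = scalarProd (conj f) (P *ᵥ g) := by
  have := hρ.correlation [f, g]
  rw [wick_pair] at this
  simpa using this

lemma trace_mul_kronecker_one (ρ : Matrix (Occ₂ n) (Occ₂ n) ℂ) (A : Matrix (Occ n) (Occ n) ℂ) :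
    (ρ * (A ⊗ₖ (1 : Matrix (Occ n) (Occ n) ℂ))).trace = (reducedA ρ * A).trace := by
  simp only [Matrix.trace, Matrix.diag_apply, Matrix.mul_apply, Fintype.sum_prod_type, reducedA,
    Matrix.of_apply, Matrix.kroneckerMap_apply, Matrix.one_apply, mul_ite, mul_one, mul_zero,
    Finset.sum_ite_eq', Finset.mem_univ, if_true, Finset.sum_mul]
  exact Finset.sum_congr rfl fun i _ => Finset.sum_comm

lemma trace_reducedA {α β : Type*} [Fintype α] [Fintype β] (σ : Matrix (α × β) (α × β) ℂ) :
    (reducedA σ).trace = σ.trace := by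
  simp [Matrix.trace, reducedA, Fintype.sum_prod_type]

lemma prod_field_inl (l : List (Loc n → ℂ)) :
    ((l.map fun f => (Sum.elim f 0 : Glob n → ℂ)).map field).prod =
      (l.map locField).prod ⊗ₖ (1 : Matrix (Occ n) (Occ n) ℂ) := by
  induction l with
  | nil => simp
  | cons f l ih =>
    simp only [List.map_cons, List.prod_cons] at ih ⊢
    rw [ih, field_inl, ← Matrix.mul_kronecker_mul, one_mul]

/-- A quasifree state with `P_AA = ½ 1` restricts to the tracial state of Alice. -/
lemma IsQuasifree.reducedA_eq {ρ : Matrix (Occ₂ n) (Occ₂ n) ℂ}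
    {P : Matrix (Glob n) (Glob n) ℂ} (hρ : IsQuasifree ρ P)
    (hP : P.toBlocks₁₁ = (1 / 2 : ℂ) • 1) :
    reducedA ρ = ((2 : ℂ) ^ n)⁻¹ • (1 : Matrix (Occ n) (Occ n) ℂ) := by
  refine eq_of_trace_mul_prod adjoin_range_locField fun l => ?_
  rw [← trace_mul_kronecker_one, ← prod_field_inl, hρ.correlation, wick_eq_trace]
  · rw [Matrix.smul_mul, one_mul, Matrix.trace_smul, smul_eq_mul, div_eq_inv_mul]
  · intro f g
    rw [scalarProd_inl_inl, hP, Matrix.smul_mulVec, Matrix.one_mulVec]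
    simp only [pairing, Pi.smul_apply, smul_eq_mul, Finset.sum_div]
    exact Finset.sum_congr rfl fun x _ => by ring

/-- The coefficients of a vector of the bipartite system, read as a matrix. -/
def amplitude (Ω : Occ₂ n → ℂ) : Matrix (Occ n) (Occ n) ℂ := Matrix.of fun I K => Ω (I, K)

lemma reducedA_vecMulVec (Ω : Occ₂ n → ℂ) :
    reducedA (Matrix.vecMulVec Ω (star Ω)) = amplitude Ω * (amplitude Ω)ᴴ := by
  ext I I'
  simp [reducedA, amplitude, Matrix.mul_apply, Matrix.vecMulVec_apply]

lemma trace_mul_one_kronecker (Ω : Occ₂ n → ℂ) (B : Matrix (Occ n) (Occ n) ℂ) :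
    (Matrix.vecMulVec Ω (star Ω) * ((1 : Matrix (Occ n) (Occ n) ℂ) ⊗ₖ B)).trace =
      ((amplitude Ω)ᴴ * amplitude Ω * Bᵀ).trace := by
  have h : ∀ I K, (∑ I', ∑ K', Ω (I, K) * star (Ω (I', K')) *
      ((1 : Matrix (Occ n) (Occ n) ℂ) I' I * B K' K)) =
      ∑ K', star (Ω (I, K')) * Ω (I, K) * B K' K := by
    intro I K
    rw [Fintype.sum_eq_single I fun I' hI => by simp [hI]]
    exact Finset.sum_congr rfl fun K' _ => by rw [Matrix.one_apply_eq]; ring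
  simp only [Matrix.trace, Matrix.diag_apply, Matrix.mul_apply, Fintype.sum_prod_type,
    Matrix.kroneckerMap_apply, Matrix.vecMulVec_apply, Matrix.conjTranspose_apply,
    Matrix.transpose_apply, amplitude, Matrix.of_apply, Pi.star_apply, Finset.sum_mul, h]
  rw [Finset.sum_comm]
  simp_rw [Finset.sum_comm (s := (Finset.univ : Finset (Occ n))) (t := Finset.univ)
    (f := fun I K' => star (Ω (I, K')) * Ω (I, _) * B K' _)]
  exact Finset.sum_comm

lemma amplitude_unitary {Ω : Occ₂ n → ℂ} {c : ℂ} (hc : c ≠ 0)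
    (h : amplitude Ω * (amplitude Ω)ᴴ = c • 1) : (amplitude Ω)ᴴ * amplitude Ω = c • 1 := by
  have h1 : (c⁻¹ • amplitude Ω) * (amplitude Ω)ᴴ = 1 := by
    rw [Matrix.smul_mul, h, smul_smul, inv_mul_cancel₀ hc, one_smul]
  have h2 := mul_eq_one_comm.mp h1
  rw [Matrix.mul_smul] at h2
  rw [← h2, smul_smul, mul_inv_cancel₀ hc, one_smul]

/-! ### Evenness of quasifree states and maximal entanglement of the blocks -/

lemma parity_kronecker_mul_field (f : Glob n → ℂ) :
    (parity n ⊗ₖ parity n) * field f = -(field f * (parity n ⊗ₖ parity n)) := by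
  rw [field_eq, mul_add, add_mul, ← Matrix.mul_kronecker_mul, ← Matrix.mul_kronecker_mul,
    ← Matrix.mul_kronecker_mul, ← Matrix.mul_kronecker_mul, parity_mul_locField,
    parity_mul_locField, one_mul, mul_one, neg_add]
  congr 1 <;> ext <;> simp [Matrix.kroneckerMap_apply]

lemma parity_kronecker_mul_self : (parity n ⊗ₖ parity n) * (parity n ⊗ₖ parity n) = 1 := by
  rw [← Matrix.mul_kronecker_mul, parity_mul_self, Matrix.one_kronecker_one]

lemma parity_kronecker_mul_prod (l : List (Glob n → ℂ)) :
    (parity n ⊗ₖ parity n) * (l.map field).prod =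
      (-1 : ℂ) ^ l.length • ((l.map field).prod * (parity n ⊗ₖ parity n)) := by
  induction l with
  | nil => simp
  | cons g t ih =>
    rw [List.map_cons, List.prod_cons, ← mul_assoc, parity_kronecker_mul_field, neg_mul, mul_assoc,
      ih]
    simp [pow_succ, mul_assoc]

/-- Quasifree states are even, because their odd correlations vanish. -/
lemma IsQuasifree.parity_conj {ρ : Matrix (Occ₂ n) (Occ₂ n) ℂ}
    {P : Matrix (Glob n) (Glob n) ℂ} (hρ : IsQuasifree ρ P) :
    (parity n ⊗ₖ parity n) * ρ * (parity n ⊗ₖ parity n) = ρ := by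
  refine eq_of_trace_mul_prod adjoin_range_field fun l => ?_
  rw [mul_assoc, parity_kronecker_mul_prod, Matrix.mul_smul, Matrix.trace_smul, mul_assoc,
    Matrix.trace_mul_comm, mul_assoc, mul_assoc, parity_kronecker_mul_self, mul_one,
    hρ.correlation]
  rcases Nat.even_or_odd l.length with h | h
  · simp [h.neg_one_pow]
  · simp [wick_of_odd _ _ h]

lemma IsQuasifree.apply_eq_zero {ρ : Matrix (Occ₂ n) (Occ₂ n) ℂ}
    {P : Matrix (Glob n) (Glob n) ℂ} (hρ : IsQuasifree ρ P) {I K I' K' : Occ n}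
    (hI : (-1 : ℤˣ) ^ I.card = (-1) ^ I'.card) (hK : (-1 : ℤˣ) ^ K.card ≠ (-1) ^ K'.card) :
    ρ (I, K) (I', K') = 0 := by
  have h := congrFun (congrFun hρ.parity_conj (I, K)) (I', K')
  rw [parity, Matrix.diagonal_kronecker_diagonal, Matrix.mul_diagonal, Matrix.diagonal_mul] at h
  have hI2 : (-1 : ℂ) ^ I.card = (-1) ^ I'.card := by
    simpa using congrArg (fun u : ℤˣ => ((u : ℤ) : ℂ)) hI
  have hK2 : (-1 : ℂ) ^ K.card = -(-1) ^ K'.card := by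
    have := Int.units_ne_iff_eq_neg.mp hK
    simpa using congrArg (fun u : ℤˣ => ((u : ℤ) : ℂ)) this
  have e1 : ((-1 : ℂ) ^ I'.card) * (-1) ^ I'.card = 1 := by simp [← mul_pow]
  have e2 : ((-1 : ℂ) ^ K'.card) * (-1) ^ K'.card = 1 := by simp [← mul_pow]
  rw [hI2, hK2] at h
  have : -ρ (I, K) (I', K') = ρ (I, K) (I', K') := by
    linear_combination h + ρ (I, K) (I', K') * ((-1) ^ K'.card * (-1) ^ K'.card) * e1 +
      ρ (I, K) (I', K') * e2
  exact CharZero.eq_neg_self_iff.mp this.symm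

/-- The state restricts to the tracial state of Alice and has definite total parity, so in
each row `a` at most one block `(a, b)` is nonzero, and it carries the tracial state on `H_a`. -/
lemma IsQuasifree.isMaximallyEntangled {ρ : Matrix (Occ₂ n) (Occ₂ n) ℂ}
    {P : Matrix (Glob n) (Glob n) ℂ} (hρ : IsQuasifree ρ P) (hpure : IsPure ρ)
    (hP : P.toBlocks₁₁ = (1 / 2 : ℂ) • 1) : IsMaximallyEntangled ρ := by
  intro a b hw
  obtain ⟨Ω, -, hΩ⟩ := hpure
  have hval : ∀ x y, ρ x y = Ω x * star (Ω y) := fun x y => by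
    rw [hΩ, Matrix.vecMulVec_apply, Pi.star_apply]
  obtain ⟨⟨I₀, K₀⟩, h₀⟩ : ∃ x : Sector n a × Sector n b, Ω (x.1.1, x.2.1) ≠ 0 := by
    by_contra! h
    exact hw (Finset.sum_eq_zero fun x _ => by
      rw [Matrix.diag_apply, block, Matrix.submatrix_apply, hval, h, zero_mul])
  -- `Ω` has the total parity `a b`
  have hzero : ∀ (I : Sector n a) (K : Occ n), (-1 : ℤˣ) ^ K.card ≠ b → Ω (I, K) = 0 := by
    intro I K hK
    have := hρ.apply_eq_zero (I := I) (K := K) (I' := I₀) (K' := K₀)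
      (I.2.trans I₀.2.symm) (fun h => hK (h.trans K₀.2))
    rw [hval] at this
    exact (mul_eq_zero.mp this).resolve_right (star_ne_zero.mpr h₀)
  have hred : reducedA (block ρ a b) = ((2 : ℂ) ^ n)⁻¹ • 1 := by
    ext I I'
    have h1 := congrFun (congrFun (hρ.reducedA_eq hP) I.1) I'.1
    have h2 : reducedA (block ρ a b) I I' = reducedA ρ I.1 I'.1 := by
      refine Fintype.sum_of_injective (Subtype.val : Sector n b → Occ n) Subtype.val_injective
        _ _ (fun K hK => ?_) (fun K => rfl)
      have : (-1 : ℤˣ) ^ K.card ≠ b := fun h => hK ⟨⟨K, h⟩, rfl⟩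
      rw [hval, hzero I K this, zero_mul]
    rw [h2, h1]
    simp [Matrix.one_apply, Subtype.ext_iff]
  have hweight : weight ρ a b = (Fintype.card (Sector n a) : ℂ) / 2 ^ n := by
    rw [weight, ← trace_reducedA, hred, Matrix.trace_smul, Matrix.trace_one, smul_eq_mul,
      div_eq_inv_mul]
  set r : ℝ := (Fintype.card (Sector n a) : ℝ) / 2 ^ n with hr
  have hwr : weight ρ a b = (r : ℂ) := by rw [hweight, hr]; push_cast; rfl
  have hr0 : 0 ≤ r := by positivity
  have hr' : r ≠ 0 := fun h => hw (by rw [hwr, h, Complex.ofReal_zero])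
  have hsq : ((√r : ℝ) : ℂ)⁻¹ * ((√r : ℝ) : ℂ)⁻¹ = (weight ρ a b)⁻¹ := by
    rw [← mul_inv, ← Complex.ofReal_mul, Real.mul_self_sqrt hr0, hwr]
  have hstate : blockState ρ a b =
      Matrix.vecMulVec (fun x : Sector n a × Sector n b => ((√r : ℝ) : ℂ)⁻¹ * Ω (x.1.1, x.2.1))
        (star fun x : Sector n a × Sector n b => ((√r : ℝ) : ℂ)⁻¹ * Ω (x.1.1, x.2.1)) := by
    ext x y
    rw [blockState, Matrix.smul_apply, block, Matrix.submatrix_apply, hval, Matrix.vecMulVec_apply,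
      Pi.star_apply, star_mul', smul_eq_mul, ← hsq, star_inv₀,
      show star ((√r : ℝ) : ℂ) = ((√r : ℝ) : ℂ) from Complex.conj_ofReal _]
    ring
  refine ⟨⟨_, ?_, hstate⟩, ?_⟩
  · rw [dotProduct_comm, ← Matrix.trace_vecMulVec, ← hstate, blockState, Matrix.trace_smul,
      ← weight, smul_eq_mul, inv_mul_cancel₀ hw]
  · have : reducedA (blockState ρ a b) = (weight ρ a b)⁻¹ • reducedA (block ρ a b) := by
      ext I I'
      simp [reducedA, blockState, Finset.mul_sum]
    rw [this, hred, smul_smul, hweight, inv_div, div_mul_eq_mul_div, mul_inv_cancel₀ (by simp),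
      one_div]

/-! ### The covariance of a maximally entangled state -/

/-- Each block of a maximally entangled state reduces to a multiple of the identity, also where
its probability vanishes. -/
lemma IsMaximallyEntangled.exists_reducedA_block {ρ : Matrix (Occ₂ n) (Occ₂ n) ℂ}
    (h : IsMaximallyEntangled ρ) (hpos : ρ.PosSemidef) (a b : ℤˣ) :
    ∃ κ : ℂ, reducedA (block ρ a b) = κ • 1 := by
  by_cases hw : weight ρ a b = 0
  -- a positive block with vanishing trace is zero
  · have : block ρ a b = 0 := ((hpos.submatrix _).trace_eq_zero_iff).mp hw
    exact ⟨0, by ext; simp [this, reducedA]⟩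
  · refine ⟨weight ρ a b * (Fintype.card (Sector n a) : ℂ)⁻¹, ?_⟩
    have h1 : block ρ a b = weight ρ a b • blockState ρ a b := by
      rw [blockState, smul_smul, mul_inv_cancel₀ hw, one_smul]
    have h2 : reducedA (block ρ a b) = weight ρ a b • reducedA (blockState ρ a b) := by
      rw [h1]; ext; simp [reducedA, Finset.mul_sum]
    rw [h2, (h a b hw).2, smul_smul]

/-- The even part of Alice's reduced state is a combination of `1` and `θ`. -/
lemma IsMaximallyEntangled.exists_reducedA_apply {ρ : Matrix (Occ₂ n) (Occ₂ n) ℂ}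
    (h : IsMaximallyEntangled ρ) (hpos : ρ.PosSemidef) :
    ∃ α β : ℂ, ∀ I I' : Occ n, (-1 : ℤˣ) ^ I.card = (-1) ^ I'.card →
      reducedA ρ I I' = (α • 1 + β • parity n : Matrix (Occ n) (Occ n) ℂ) I I' := by
  choose κ hκ using h.exists_reducedA_block hpos
  set d : ℤˣ → ℂ := fun a => ∑ b, κ a b
  have key : ∀ (a : ℤˣ) (I I' : Sector n a), reducedA ρ I.1 I'.1 = if I = I' then d a else 0 := by
    intro a I I'
    have h1 : reducedA ρ I.1 I'.1 = ∑ b, reducedA (block ρ a b) I I' :=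
      (Fintype.sum_fiberwise (fun K : Occ n => (-1 : ℤˣ) ^ K.card)
        fun K => ρ (I.1, K) (I'.1, K)).symm
    rw [h1]
    simp only [hκ, Matrix.smul_apply, Matrix.one_apply, smul_eq_mul, mul_ite, mul_one, mul_zero]
    split_ifs <;> simp [d]
  refine ⟨(d 1 + d (-1)) / 2, (d 1 - d (-1)) / 2, fun I I' hI => ?_⟩
  rw [key _ ⟨I, rfl⟩ ⟨I', hI.symm⟩, Matrix.add_apply, Matrix.smul_apply, Matrix.smul_apply, parity,
    Matrix.diagonal_apply, Matrix.one_apply]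
  simp only [Subtype.mk.injEq, smul_eq_mul]
  split_ifs
  · rcases Nat.even_or_odd I.card with h | h <;> simp only [h.neg_one_pow] <;> ring
  · simp

/-- Products of two fields are even. -/
lemma locField_mul_locField_apply (f g : Loc n → ℂ) {I I' : Occ n}
    (h : (-1 : ℤˣ) ^ I.card ≠ (-1) ^ I'.card) : (locField f * locField g) I I' = 0 := by
  have h1 : parity n * (locField f * locField g) = locField f * locField g * parity n := by
    simpa using parity_mul_prod [f, g]
  have h2 := congrFun (congrFun h1 I) I'
  have h3 : (-1 : ℂ) ^ I.card = -(-1) ^ I'.card := by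
    simpa using congrArg (fun u : ℤˣ => ((u : ℤ) : ℂ)) (Int.units_ne_iff_eq_neg.mp h)
  have h4 : ((-1 : ℂ) ^ I'.card) * (-1) ^ I'.card = 1 := by simp [← mul_pow]
  rw [parity, Matrix.diagonal_mul, Matrix.mul_diagonal, h3] at h2
  linear_combination (-(locField f * locField g) I I') * h4 - (-1) ^ I'.card / 2 * h2

lemma IsMaximallyEntangled.toBlocks₁₁ (hn : 2 ≤ n) {ρ : Matrix (Occ₂ n) (Occ₂ n) ℂ}
    {P : Matrix (Glob n) (Glob n) ℂ} (h : IsMaximallyEntangled ρ) (hρ : IsQuasifree ρ P) :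
    P.toBlocks₁₁ = (1 / 2 : ℂ) • 1 := by
  obtain ⟨α, β, hαβ⟩ := h.exists_reducedA_apply hρ.isState.posSemidef
  have hα : α * 2 ^ n = 1 := by
    have h1 := hρ.isState.trace_eq_one
    rw [← trace_reducedA, Matrix.trace] at h1
    simp only [Matrix.diag_apply, hαβ _ _ rfl] at h1
    have h2 : (α • 1 + β • parity n : Matrix (Occ n) (Occ n) ℂ).trace = 1 := h1
    rw [Matrix.trace_add, Matrix.trace_smul, Matrix.trace_smul, trace_parity (by omega),
      Matrix.trace_one, Fintype.card_finset, Fintype.card_fin] at h2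
    simpa using h2
  refine eq_half_of_pairing fun f g => ?_
  have h1 : (reducedA ρ * (locField f * locField g)).trace =
      ((α • 1 + β • parity n : Matrix (Occ n) (Occ n) ℂ) * (locField f * locField g)).trace := by
    have hev := @locField_mul_locField_apply n f g
    simp only [Matrix.trace, Matrix.diag_apply]
    generalize locField f * locField g = B at hev ⊢
    simp only [Matrix.mul_apply]
    refine Finset.sum_congr rfl fun I _ => Finset.sum_congr rfl fun I' _ => ?_
    by_cases hI : (-1 : ℤˣ) ^ I.card = (-1) ^ I'.card
    · rw [hαβ I I' hI]
    · simp only [hev (Ne.symm hI), mul_zero]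
  rw [← scalarProd_inl_inl, ← hρ.trace_field_mul_field, field_inl, field_inl,
    ← Matrix.mul_kronecker_mul, mul_one, trace_mul_kronecker_one, h1, add_mul, Matrix.smul_mul,
    Matrix.smul_mul, Matrix.trace_add, Matrix.trace_smul, Matrix.trace_smul,
    trace_parity_mul_locField hn, one_mul, trace_locField_mul, smul_eq_mul]
  linear_combination pairing f g / 2 * hα

lemma toBlocks₂₂_of_amplitude {ρ : Matrix (Occ₂ n) (Occ₂ n) ℂ}
    {P : Matrix (Glob n) (Glob n) ℂ} (hρ : IsQuasifree ρ P) {Ω : Occ₂ n → ℂ}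
    (hΩ : ρ = Matrix.vecMulVec Ω (star Ω))
    (hX : (amplitude Ω)ᴴ * amplitude Ω = ((2 : ℂ) ^ n)⁻¹ • 1) :
    P.toBlocks₂₂ = (1 / 2 : ℂ) • 1 := by
  refine eq_half_of_pairing fun f g => ?_
  rw [← scalarProd_inr_inr, ← hρ.trace_field_mul_field, field_inr, field_inr,
    ← Matrix.mul_kronecker_mul, parity_mul_self, hΩ, trace_mul_one_kronecker, hX, Matrix.smul_mul,
    one_mul, Matrix.trace_smul, Matrix.trace_transpose, trace_locField_mul, smul_eq_mul]
  field_simp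

/-- The Wick sum of `f, f_1, …, f_m` depends on `f` only through its contractions with the
`f_i`. -/
lemma wick_cons_congr {S : Matrix (Glob n) (Glob n) ℂ} {f f' : Glob n → ℂ}
    {l : List (Glob n → ℂ)}
    (h : ∀ g ∈ l, scalarProd (conj f) (S *ᵥ g) = scalarProd (conj f') (S *ᵥ g)) :
    wick S (f :: l) = wick S (f' :: l) := by
  rw [wick_cons, wick_cons]
  exact Finset.sum_congr rfl fun i _ => by rw [h _ (l.get_mem i)]

/-- Alice's operators act cyclically on a vector with invertible amplitude: an operator `D` whose
correlations with all of Alice's operators vanish is annihilated by the state. -/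
lemma mul_eq_zero_of_cyclic {ρ D : Matrix (Occ₂ n) (Occ₂ n) ℂ} {Ω : Occ₂ n → ℂ}
    (hΩ : ρ = Matrix.vecMulVec Ω (star Ω)) {c : ℂ} (hc : c ≠ 0)
    (hX : (amplitude Ω)ᴴ * amplitude Ω = c • 1)
    (hD : ∀ A : Matrix (Occ n) (Occ n) ℂ,
      (ρ * D * (A ⊗ₖ (1 : Matrix (Occ n) (Occ n) ℂ))).trace = 0) : ρ * D = 0 := by
  have key : ∀ w : Occ₂ n → ℂ, (star Ω ᵥ* D) ⬝ᵥ w = 0 := by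
    intro w
    set A := c⁻¹ • (amplitude w * (amplitude Ω)ᴴ)
    have hA : (A ⊗ₖ (1 : Matrix (Occ n) (Occ n) ℂ)) *ᵥ Ω = w := by
      have h1 : A * amplitude Ω = amplitude w := by
        rw [Matrix.smul_mul, mul_assoc, hX, Matrix.mul_smul, mul_one, smul_smul,
          inv_mul_cancel₀ hc, one_smul]
      funext ⟨I, K⟩
      have h2 := congrFun (congrFun h1 I) K
      simpa [Matrix.mul_apply, Matrix.mulVec, dotProduct, Fintype.sum_prod_type,
        Matrix.one_apply, amplitude] using h2
    have h3 := hD A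
    rwa [hΩ, Matrix.vecMulVec_mul, Matrix.vecMulVec_mul, Matrix.trace_vecMulVec, dotProduct_comm,
      ← Matrix.dotProduct_mulVec, hA] at h3
  rw [hΩ, Matrix.vecMulVec_mul, dotProduct_eq_zero _ key, Matrix.vecMulVec_zero]

lemma pairing_conjLoc (f g : Loc n → ℂ) : pairing (conjLoc f) g = star f ⬝ᵥ g := by
  simp [pairing, conjLoc, dotProduct]

/-- Bob's field `B(Γ g)` acts on the state like Alice's field `B(Γ U g)`, where `U = 2 P_AB`:
by Wick's theorem both have the same correlations with Alice's operators. Comparing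
two-point functions with Bob's fields shows that `U` is an isometry. -/
lemma IsQuasifree.unitary {ρ : Matrix (Occ₂ n) (Occ₂ n) ℂ}
    {P : Matrix (Glob n) (Glob n) ℂ} (hρ : IsQuasifree ρ P) {Ω : Occ₂ n → ℂ}
    (hΩ : ρ = Matrix.vecMulVec Ω (star Ω)) (h11 : P.toBlocks₁₁ = (1 / 2 : ℂ) • 1)
    (h21 : P.toBlocks₂₁ = P.toBlocks₁₂ᴴ) :
    P.toBlocks₂₂ = (1 / 2 : ℂ) • 1 ∧
      (2 : ℂ) • P.toBlocks₁₂ ∈ Matrix.unitaryGroup (Loc n) ℂ := by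
  have hc : ((2 : ℂ) ^ n)⁻¹ ≠ 0 := by simp
  have hX : (amplitude Ω)ᴴ * amplitude Ω = ((2 : ℂ) ^ n)⁻¹ • 1 :=
    amplitude_unitary hc (by rw [← reducedA_vecMulVec, ← hΩ, hρ.reducedA_eq h11])
  have h22 := toBlocks₂₂_of_amplitude hρ hΩ hX
  refine ⟨h22, ?_⟩
  set V := P.toBlocks₁₂
  -- `⟨g, P_BA f⟩ = ½ ⟨U g, f⟩`: both fields have the same contractions with Alice's fields
  have hD : ∀ g : Loc n → ℂ, ρ * (field (Sum.elim 0 (conjLoc g)) -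
      field (Sum.elim (conjLoc ((2 : ℂ) • V *ᵥ g)) 0)) = 0 := by
    intro g
    refine mul_eq_zero_of_cyclic hΩ hc hX fun A => ?_
    rw [trace_mul_kronecker_one]
    suffices h : reducedA (ρ * (field (Sum.elim 0 (conjLoc g)) -
        field (Sum.elim (conjLoc ((2 : ℂ) • V *ᵥ g)) 0))) = 0 by
      rw [h, zero_mul, Matrix.trace_zero]
    refine eq_of_trace_mul_prod adjoin_range_locField fun l => ?_
    have hcorr : ∀ f : Glob n → ℂ, (ρ * field f * ((l.map locField).prod ⊗ₖ
        (1 : Matrix (Occ n) (Occ n) ℂ))).trace =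
        wick P (f :: l.map fun f => Sum.elim f 0) := fun f => by
      rw [← prod_field_inl, mul_assoc, ← hρ.correlation, List.map_cons, List.prod_cons]
    rw [← trace_mul_kronecker_one, zero_mul, Matrix.trace_zero, mul_sub, sub_mul,
      Matrix.trace_sub, hcorr, hcorr, sub_eq_zero]
    refine wick_cons_congr fun k hk => ?_
    obtain ⟨f, -, rfl⟩ := List.mem_map.mp hk
    rw [scalarProd_inr_inl, scalarProd_inl_inl, pairing_conjLoc, pairing_conjLoc, h11, h21,
      Matrix.smul_mulVec, Matrix.one_mulVec, star_smul, smul_dotProduct, dotProduct_smul,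
      Matrix.star_mulVec, Matrix.dotProduct_mulVec]
    simp
  rw [Matrix.mem_unitaryGroup_iff', Matrix.star_eq_conjTranspose]
  refine Matrix.ext_of_mulVec_single fun i => dotProduct_eq _ _ fun g => ?_
  generalize (Pi.single i 1 : Loc n → ℂ) = k
  have h1 := congrArg (fun M => (M * field (Sum.elim 0 k)).trace) (hD (star g))
  simp only [zero_mul, Matrix.trace_zero, mul_sub, sub_mul, Matrix.trace_sub, mul_assoc,
    hρ.trace_field_mul_field, scalarProd_inr_inr, scalarProd_inl_inr, pairing_conjLoc, h22,
    star_star, sub_eq_zero] at h1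
  rw [star_smul, smul_dotProduct, Matrix.star_mulVec, star_star, Matrix.smul_mulVec,
    Matrix.one_mulVec, dotProduct_smul, ← Matrix.dotProduct_mulVec] at h1
  rw [Matrix.one_mulVec, dotProduct_comm, dotProduct_comm k, Matrix.conjTranspose_smul,
    Matrix.smul_mul, Matrix.mul_smul, Matrix.smul_mulVec, Matrix.smul_mulVec, dotProduct_smul,
    dotProduct_smul, ← Matrix.mulVec_mulVec]
  simp only [smul_eq_mul, star_ofNat] at h1 ⊢
  linear_combination -2 * h1

end Fermion

theorem theorem1 (n : ℕ) (hn : 2 ≤ n)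
    (P : Matrix (Fermion.Glob n) (Fermion.Glob n) ℂ)
    (ρ : Matrix (Fermion.Occ₂ n) (Fermion.Occ₂ n) ℂ)
    (hρ : Fermion.IsQuasifree ρ P) (hpure : Fermion.IsPure ρ) :
    Fermion.IsMaximallyEntangled ρ ↔
      ∃ U : Matrix (Fermion.Loc n) (Fermion.Loc n) ℂ,
        U ∈ Matrix.unitaryGroup (Fermion.Loc n) ℂ ∧
        (∀ f : Fermion.Loc n → ℂ,
          Fermion.conjLoc (U *ᵥ f) = -(U *ᵥ Fermion.conjLoc f)) ∧
        P = (1 / 2 : ℂ) • Matrix.fromBlocks 1 U Uᴴ 1 := by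
  constructor
  · intro h
    obtain ⟨Ω, -, hΩ⟩ := hpure
    have h11 := h.toBlocks₁₁ hn hρ
    have h21 : P.toBlocks₂₁ = P.toBlocks₁₂ᴴ := by
      conv_lhs => rw [← hρ.isCovariance.nonneg.isHermitian.eq]
      rfl
    obtain ⟨h22, hU⟩ := hρ.unitary hΩ h11 h21
    refine ⟨_, hU, fun f => ?_, ?_⟩
    · have h1 := hρ.isCovariance.add_conj (Sum.elim 0 (Fermion.conjLoc f))
      funext x
      have h2 := congrFun h1 (.inl x)
      have h3 : Fermion.conj (Sum.elim 0 (Fermion.conjLoc f) : Fermion.Glob n → ℂ) =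
          (Sum.elim 0 f : Fermion.Glob n → ℂ) := by
        funext y
        rcases y with y | y <;> simp [Fermion.conj, Fermion.conjLoc]
      rw [h3, ← Matrix.fromBlocks_toBlocks P, Matrix.fromBlocks_mulVec,
        Matrix.fromBlocks_mulVec] at h2
      simp only [Fermion.conj, Fermion.conjLoc, Sum.elim_comp_inl, Sum.elim_comp_inr,
        Matrix.mulVec_zero, zero_add, Pi.add_apply, Sum.elim_inl, Pi.zero_apply] at h2
      simp only [Fermion.conjLoc, Matrix.smul_mulVec, Pi.smul_apply, Pi.neg_apply, smul_eq_mul,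
        star_mul', star_ofNat]
      linear_combination 2 * h2
    · rw [← Matrix.fromBlocks_toBlocks P, Matrix.fromBlocks_smul, h11, h22, h21]
      simp [Matrix.conjTranspose_smul, smul_smul]
  · rintro ⟨U, -, -, hP⟩
    refine hρ.isMaximallyEntangled hpure ?_
    rw [hP, Matrix.fromBlocks_smul, Matrix.toBlocks_fromBlocks₁₁]

end
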